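/- For every $n \ge 0$ there is a constant $C(n)$, depending only on $n$, such that the following holds. Let $\mathbf{F}$ be a finite field of characteristic $p$, let $L = \mathrm{GL}_n(\mathbf{F})$, and let $N \trianglelefteq \Gamma \le L$ be subgroups such that the section $\Sigma = \Gamma/N$ is soluble. Let $O_p(\Sigma)$ denote the largest normal $p$-subgroup of $\Sigma$, and let $R = N_L(\Gamma) \cap N_L(N)$, which acts on $\Sigma$ by conjugation. Then $\Sigma$ has a characteristic subgroup $\Sigma_0 = \Gamma_0/N$ (with $N \le \Gamma_0 \le \Gamma$) such that (a) $[\Sigma : \Sigma_0] \le C(n)$ and $O_p(\Sigma) \le \Sigma_0$; (b) $\Sigma_0$ is trigonalizable, that is, there is a subgroup $B \le L$ that is conjugate in $\mathrm{GL}_n(\mathbf{E})$, for some extension field $\mathbf{E}$ of $\mathbf{F}$, to a group of upper-triangular matrices, and such that $B \cap \Gamma_0$ maps onto $\Sigma_0 = \Gamma_0/N$; (c) $[R : C_R(\Sigma_0/O_p(\Sigma))] \le n!$, where $C_R(\Sigma_0/O_p(\Sigma))$ is the set of elements of $R$ that act trivially by conjugation on $\Sigma_0/O_p(\Sigma)$.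 -/

import Mathlib

universe u

/-- The `p`-core `O_p(G)`: the subgroup generated by all normal `p`-subgroups of `G`, which for a
finite group is the largest normal `p`-subgroup. -/
def pCore (p : ℕ) (G : Type*) [Group G] : Subgroup G :=
  sSup {H : Subgroup G | H.Normal ∧ IsPGroup p H}

/-- The underlying quotient `H / N` of a section of `G`; used when `N ≤ H` and `N` is normal
in `H`. -/
abbrev SectionQuot {G : Type*} [Group G] (H N : Subgroup G) : Type _ :=
  H ⧸ N.subgroupOf H

/-- The trace `tr(A, H / N)`: the projection of `A ∩ H` to `H / N`. -/
def sectionTrace {G : Type*} [Group G] (A : Set G) (H N : Subgroup G) : Set (SectionQuot H N) :=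
  (fun h : H => (QuotientGroup.mk h : SectionQuot H N)) '' {h : H | (h : G) ∈ A}

/-- The preimage in `H ≤ G` of a subgroup `K` of the section `H / N`. Thus `K` is the section
`sectionPreimage H N K / N` of `G`. -/
def sectionPreimage {G : Type*} [Group G] (H N : Subgroup G) [(N.subgroupOf H).Normal]
    (K : Subgroup (SectionQuot H N)) : Subgroup G :=
  (K.comap (QuotientGroup.mk' (N.subgroupOf H))).map H.subtype

/-- The normalizer `N_G(H / N) = N_G(H) ∩ N_G(N)` of a section. -/
def sectionNormalizer {G : Type*} [Group G] (H N : Subgroup G) : Subgroup G :=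
  Subgroup.normalizer (H : Set G) ⊓ Subgroup.normalizer (N : Set G)

/-- The centralizer `C_G(H / N)` of a section: the elements `g` of its normalizer such that
conjugation by `g` is trivial on `H / N`, i.e. `g h g⁻¹ N = h N` for all `h ∈ H`. -/
def sectionCentralizer {G : Type*} [Group G] (H N : Subgroup G) : Subgroup G where
  carrier := {g | g ∈ sectionNormalizer H N ∧ ∀ h ∈ H, h⁻¹ * (g * h * g⁻¹) ∈ N}
  one_mem' := ⟨one_mem _, fun h _ => by simp⟩
  mul_mem' := by
    rintro a b ⟨ha, ha'⟩ ⟨hb, hb'⟩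
    refine ⟨mul_mem ha hb, fun h hh => ?_⟩
    have h1 := (Subgroup.mem_normalizer_iff.1 ha.2 _).1 (hb' h hh)
    have h2 := mul_mem (ha' h hh) h1
    convert h2 using 1
    group
  inv_mem' := by
    rintro a ⟨ha, ha'⟩
    refine ⟨inv_mem ha, fun h hh => ?_⟩
    have h1 := (Subgroup.mem_normalizer_iff.1 (inv_mem ha).1 h).1 hh
    have h2 := inv_mem (ha' _ h1)
    convert h2 using 1
    group

/-- A subgroup of `GL_n(F)` is trigonalizable if over some extension field `E` of `F` it is
conjugate in `GL_n(E)` to a group of upper-triangular matrices. -/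
def IsTrigonalizable {n : ℕ} {F : Type u} [Field F]
    (B : Subgroup (Matrix.GeneralLinearGroup (Fin n) F)) : Prop :=
  ∃ (E : Type u) (_ : Field E) (_ : Algebra F E) (x : Matrix.GeneralLinearGroup (Fin n) E),
    ∀ b ∈ B, Matrix.BlockTriangular
      (x * Matrix.GeneralLinearGroup.map (algebraMap F E) b * x⁻¹ :
        Matrix.GeneralLinearGroup (Fin n) E).val id

/-- A section `H / N` of `GL_n(F)` is trigonalizable if it is the trace of a trigonalizable
subgroup. -/
def IsTrigonalizableSection {n : ℕ} {F : Type u} [Field F]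
    (H N : Subgroup (Matrix.GeneralLinearGroup (Fin n) F)) : Prop :=
  ∃ B : Subgroup (Matrix.GeneralLinearGroup (Fin n) F),
    IsTrigonalizable B ∧ sectionTrace (B : Set _) H N = Set.univ

/-!
Over the algebraic closure, Mal'cev's theorem gives a solvable linear group of degree `n` a
trigonalizable normal subgroup of index bounded in `n`; a suitable exponent `m`, depending only
on `n`, sends every element into it. Write `R` for the normalizer of the section `Σ`, and pass to
the quotient of `R` by the preimage of `O_p(Σ)`. The image of `Σ` there is a normal solvable
subgroup with trivial `p`-core. To lift its subgroup of `m`-th powers to a trigonalizable group,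
first replace `R` by a Frattini supplement of the kernel, which makes the kernel solvable. The
lift `A` acts through diagonal characters up to a `p`-group, and `p`-groups disappear because the
`p`-core is trivial: so the index is bounded by counting `m`-th powers of diagonal matrices, and
the elements permuting the at most `n` weights of `A` trivially centralize its image, which gives
`n!`. A Sylow `p`-subgroup of the kernel is unipotent and normalized by `A`, so adjoining it
keeps the group trigonalizable, and it covers `O_p(Σ)`.
-/

open scoped commutatorElement

section Eigencharacters

variable {K G V : Type*} [Field K] [AddCommGroup V] [Module K V]

theorem exists_common_eigenvector {ι : Type*} [IsAlgClosed K] [FiniteDimensional K V]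
    [Nontrivial V] (T : ι → Module.End K V) (hT : ∀ i j, Commute (T i) (T j)) :
    ∃ v : V, v ≠ 0 ∧ ∀ i, ∃ c : K, T i v = c • v := by
  let A := Algebra.adjoin K (Set.range T)
  have : IsMulCommutative A := Algebra.isMulCommutative_adjoin K <| by
    rintro _ ⟨i, rfl⟩ _ ⟨j, rfl⟩
    exact hT i j
  have : IsArtinian A V := isArtinian_of_tower K inferInstance
  obtain ⟨S, hS, -⟩ := (eq_bot_or_exists_atom_le (⊤ : Submodule A V)).resolve_left top_ne_bot
  have : IsSimpleModule A S := isSimpleModule_iff_isAtom.2 hS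
  have : FiniteDimensional K S := FiniteDimensional.of_injective
    (S.subtype.restrictScalars K) S.injective_subtype
  obtain ⟨v, hv, hv0⟩ := Submodule.exists_mem_ne_zero_of_ne_bot hS.1
  have hspan := (finrank_eq_one_iff_of_nonzero' (⟨v, hv⟩ : S) (by simpa using hv0)).1
    (IsSimpleModule.finrank_eq_one_of_isMulCommutative A S K)
  refine ⟨v, hv0, fun i => ?_⟩
  obtain ⟨c, hc⟩ := hspan ((⟨T i, Algebra.subset_adjoin ⟨i, rfl⟩⟩ : A) • ⟨v, hv⟩)
  exact ⟨c, (congrArg Subtype.val hc).symm⟩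

theorem exists_eigencharacter [Monoid G] (ρ : Representation K G V) {v : V} (hv : v ≠ 0)
    (h : ∀ g, ∃ c : K, ρ g v = c • v) : ∃ χ : G →* K, ∀ g, ρ g v = χ g • v := by
  choose c hc using h
  have hinj := smul_left_injective K hv
  exact ⟨{ toFun := c
           map_one' := hinj <| by simp [← hc]
           map_mul' := fun a b => hinj <| by
             simp [← hc, mul_comm (c a), mul_smul, ← map_smul] }, hc⟩

theorem linearIndependent_of_eigencharacters [Monoid G] {κ : Type*} (ρ : Representation K G V)
    {χ : κ → G →* K} (hχ : Function.Injective χ) {v : κ → V} (hv : ∀ k, v k ≠ 0)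
    (h : ∀ k g, ρ g (v k) = χ k g • v k) : LinearIndependent K v := by
  have hind := (linearIndependent_monoidHom G K).comp χ hχ
  rw [linearIndependent_iff'] at hind ⊢
  intro s c hc k hk
  obtain ⟨φ, hφ⟩ : ∃ φ : Module.Dual K V, φ (v k) ≠ 0 := by
    by_contra! h0
    exact hv k ((Module.forall_dual_apply_eq_zero_iff K (v k)).1 h0)
  have hcoeff := hind s (fun j => c j * φ (v j)) (by
    funext g
    have hg := congrArg (φ ∘ ρ g) hc
    simpa [h, mul_comm, mul_left_comm] using hg) k hk
  exact (mul_eq_zero.1 hcoeff).resolve_right hφ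

variable [Group G]

/-- The inertia subgroup of a linear character of a normal subgroup `A`: the elements whose
conjugation action on `A` fixes the character. -/
def inertiaSubgroup (A : Subgroup G) [A.Normal] (χ : A →* K) : Subgroup G where
  carrier := {g | ∀ a, χ (MulAut.conjNormal g a) = χ a}
  one_mem' a := by simp
  mul_mem' {g h} hg hh a := by rw [map_mul, MulAut.mul_apply, hg, hh]
  inv_mem' {g} hg a := by rw [← hg, ← MulAut.mul_apply, ← map_mul, mul_inv_cancel, map_one,
    MulAut.one_apply]

theorem le_inertiaSubgroup (A : Subgroup G) [A.Normal] (χ : A →* K) : A ≤ inertiaSubgroup A χ := by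
  intro g hg a
  have hconj : MulAut.conjNormal g a = ⟨g, hg⟩ * a * ⟨g, hg⟩⁻¹ := Subtype.ext rfl
  rw [hconj, map_mul, map_mul, mul_right_comm, ← map_mul, mul_inv_cancel, map_one, one_mul]

/-- The translates of a joint eigenvector of `A` along the cosets of the inertia subgroup afford
distinct characters of `A`. -/
theorem index_inertiaSubgroup_le_finrank [FiniteDimensional K V] (ρ : Representation K G V)
    {A : Subgroup G} [A.Normal] {χ : A →* K} {v : V} (hv : v ≠ 0)
    (h : ∀ a : A, ρ a v = χ a • v) :
    (inertiaSubgroup A χ).index ≠ 0 ∧ (inertiaSubgroup A χ).index ≤ Module.finrank K V := by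
  let conjχ (q : G ⧸ inertiaSubgroup A χ) : A →* K :=
    χ.comp (MulAut.conjNormal q.out⁻¹).toMonoidHom
  have hdistinct : Function.Injective conjχ := by
    intro q r hqr
    rw [← QuotientGroup.out_eq' q, ← QuotientGroup.out_eq' r]
    refine QuotientGroup.eq.2 fun a => ?_
    simpa [conjχ, map_mul] using DFunLike.congr_fun hqr (MulAut.conjNormal r.out a)
  have hind := linearIndependent_of_eigencharacters (ρ.comp A.subtype) hdistinct
    (v := fun q => ρ q.out v) (fun q h0 => hv (by simpa using congrArg (ρ q.out⁻¹) h0))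
    (fun q a => by
      have hconj : (a : G) * q.out = q.out * (MulAut.conjNormal q.out⁻¹ a : A) := by
        simp [mul_assoc]
      have := congrArg (ρ q.out) (h (MulAut.conjNormal q.out⁻¹ a))
      rw [← Module.End.mul_apply, ← map_mul, ← hconj] at this
      simpa [conjχ] using this)
  have := hind.finite
  have := Fintype.ofFinite (G ⧸ inertiaSubgroup A χ)
  refine ⟨Subgroup.index_ne_zero_of_finite, ?_⟩
  rw [Subgroup.index, Nat.card_eq_fintype_card]
  exact hind.fintype_card_le_finrank

end Eigencharacters

section InvariantSubspaces

variable {K G V : Type*} [Field K] [Group G] [AddCommGroup V] [Module K V]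

theorem exists_derivedSeries_forall_scalar [Group.IsSolvable G] (ρ : Representation K G V) {g : G}
    (hns : ∀ c : K, ρ g ≠ c • 1) :
    ∃ k, (∃ b ∈ derivedSeries G k, ∀ c : K, ρ b ≠ c • 1) ∧
      ∀ x ∈ derivedSeries G (k + 1), ∃ c : K, ρ x = c • 1 := by
  classical
  have hex : ∃ k, ∀ x ∈ derivedSeries G k, ∃ c : K, ρ x = c • 1 := by
    obtain ⟨k, hk⟩ := Group.IsSolvable.solvable (G := G)
    exact ⟨k, fun x hx => ⟨1, by rw [hk, Subgroup.mem_bot] at hx; simp [hx]⟩⟩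
  obtain ⟨k, hk⟩ : ∃ k, Nat.find hex = k + 1 := by
    refine Nat.exists_eq_succ_of_ne_zero fun h0 => ?_
    obtain ⟨c, hc⟩ := Nat.find_spec hex g (by simp [h0])
    exact hns c hc
  refine ⟨k, ?_, hk ▸ Nat.find_spec hex⟩
  simpa using Nat.find_min hex (m := k) (by omega)

variable [IsAlgClosed K] [FiniteDimensional K V]

theorem exists_invariant_of_normal_commuting (ρ : Representation K G V) (A : Subgroup G)
    [A.Normal] (hcomm : ∀ a ∈ A, ∀ b ∈ A, Commute (ρ a) (ρ b)) {a : G} (ha : a ∈ A)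
    (hns : ∀ c : K, ρ a ≠ c • 1) :
    ∃ (H : Subgroup G) (W : Submodule K V), H.index ≠ 0 ∧ H.index ≤ Module.finrank K V ∧
      W ≠ ⊥ ∧ W ≠ ⊤ ∧ ∀ h ∈ H, W ≤ W.comap (ρ h) := by
  have : Nontrivial V := not_subsingleton_iff_nontrivial.1 fun _ => hns 0 (Subsingleton.elim _ _)
  obtain ⟨v, hv0, hv⟩ := exists_common_eigenvector (fun a : A => ρ a)
    fun a b => hcomm a a.2 b b.2
  obtain ⟨χ, hχ⟩ := exists_eigencharacter (ρ.comp A.subtype) hv0 hv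
  let W : Submodule K V := ⨅ a : A, Module.End.eigenspace (ρ a) (χ a)
  have mem_W (w : V) : w ∈ W ↔ ∀ a : A, ρ a w = χ a • w := by
    simp [W, Submodule.mem_iInf]
  obtain ⟨hfin, hle⟩ := index_inertiaSubgroup_le_finrank ρ hv0 hχ
  refine ⟨inertiaSubgroup A χ, W, hfin, hle, ?_, ?_, ?_⟩
  · exact (Submodule.ne_bot_iff W).2 ⟨v, (mem_W v).2 hχ, hv0⟩
  · intro htop
    refine hns (χ ⟨a, ha⟩) (LinearMap.ext fun w => ?_)
    exact (mem_W w).1 (htop ▸ Submodule.mem_top) ⟨a, ha⟩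
  · intro h hh w hw
    refine (mem_W _).2 fun a => ?_
    have hconj : (a : G) * h = h * (MulAut.conjNormal h⁻¹ a : A) := by simp [mul_assoc]
    rw [← Module.End.mul_apply, ← map_mul, hconj, map_mul, Module.End.mul_apply,
      (mem_W w).1 hw, inv_mem hh, map_smul]

theorem exists_invariant_of_commuting_conjugates (ρ : Representation K G V) {b : G}
    (hcomm : ∀ g, Commute (ρ (g * b * g⁻¹)) (ρ b)) (hns : ∀ c : K, ρ b ≠ c • 1) :
    ∃ (H : Subgroup G) (W : Submodule K V), H.index ≠ 0 ∧ H.index ≤ Module.finrank K V ∧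
      W ≠ ⊥ ∧ W ≠ ⊤ ∧ ∀ h ∈ H, W ≤ W.comap (ρ h) := by
  have conj_commute : ∀ x ∈ Group.conjugatesOfSet {b}, ∀ y ∈ Group.conjugatesOfSet {b},
      Commute (ρ.asGroupHom x) (ρ.asGroupHom y) := by
    simp only [Group.mem_conjugatesOfSet_iff, Set.mem_singleton_iff, exists_eq_left, isConj_iff]
    rintro _ ⟨g, rfl⟩ _ ⟨h, rfl⟩
    have hgh : Commute (ρ.asGroupHom (h⁻¹ * g * b * (h⁻¹ * g)⁻¹)) (ρ.asGroupHom b) :=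
      Units.ext (hcomm (h⁻¹ * g))
    simpa [mul_assoc] using hgh.conj (ρ.asGroupHom h)
  refine exists_invariant_of_normal_commuting ρ (Subgroup.normalClosure {b}) (fun x hx y hy => ?_)
    (Subgroup.subset_normalClosure rfl) hns
  suffices Commute (ρ.asGroupHom x) (ρ.asGroupHom y) from this.units_val
  induction hx, hy using Subgroup.closure_induction₂ with
  | mem x y hx hy => exact conj_commute x hx y hy
  | one_left => simp
  | one_right => simp
  | mul_left _ _ _ _ _ _ h₁ h₂ => simpa using h₁.mul_left h₂
  | mul_right _ _ _ _ _ _ h₁ h₂ => simpa using h₁.mul_right h₂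
  | inv_left _ _ _ _ h => simpa using h.inv_left
  | inv_right _ _ _ _ h => simpa using h.inv_right

/-- Let `B` be the last term of the derived series that does not act by scalars, and let `b` be
an element of `B` that does not. Since `⁅B, B⁆` acts by scalars, `B` acts on the line spanned by
`ρ b` in `End V` through a character. Elements that fix this character conjugate `b` to elements
that commute with `b`. -/
theorem exists_invariant_of_isSolvable [Group.IsSolvable G] (ρ : Representation K G V) {g : G}
    (hns : ∀ c : K, ρ g ≠ c • 1) :
    ∃ (H : Subgroup G) (W : Submodule K V), H.index ≠ 0 ∧ H.index ≤ Module.finrank K V ^ 3 ∧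
      W ≠ ⊥ ∧ W ≠ ⊤ ∧ ∀ h ∈ H, W ≤ W.comap (ρ h) := by
  obtain ⟨k, ⟨b, hb, hbns⟩, hscalar⟩ := exists_derivedSeries_forall_scalar ρ hns
  let B := derivedSeries G k
  have apply_conj (x y : G) : ρ (x * y * x⁻¹) = Representation.linHom ρ ρ x (ρ y) := by
    rw [map_mul, map_mul, mul_assoc]; rfl
  have hb0 : ρ b ≠ 0 := fun h => hbns 0 (by rw [h, zero_smul])
  obtain ⟨χ, hχ⟩ := exists_eigencharacter ((Representation.linHom ρ ρ).comp B.subtype) hb0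
    fun x => by
      obtain ⟨c, hc⟩ := hscalar ⁅(x : G), b⁆ (Subgroup.commutator_mem_commutator x.2 hb)
      refine ⟨c, (apply_conj x b).symm.trans ?_⟩
      rw [← one_mul (ρ b), ← smul_mul_assoc, ← hc, ← map_mul, commutatorElement_def,
        inv_mul_cancel_right]
  obtain ⟨hfin, hle⟩ := index_inertiaSubgroup_le_finrank (Representation.linHom ρ ρ) hb0 hχ
  replace hχ (x : B) : ρ (x * b * (x : G)⁻¹) = χ x • ρ b := (apply_conj x b).trans (hχ x)
  let H := inertiaSubgroup B χ
  have hcomm (h : H) : Commute (ρ (h * b * (h : G)⁻¹)) (ρ b) := by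
    have hχb : χ ⟨b, hb⟩ = 1 := smul_left_injective K hb0 (by simp [← hχ])
    have hfix : ρ (h * b * (h : G)⁻¹ * b * (h * b * (h : G)⁻¹)⁻¹) = ρ b :=
      (hχ (MulAut.conjNormal (h : G) ⟨b, hb⟩)).trans (by rw [h.2, hχb, one_smul])
    rw [commute_iff_eq, ← map_mul]
    conv_rhs => rw [← hfix, ← map_mul, inv_mul_cancel_right]
  obtain ⟨H', W, hfin', hle', hbot, htop, hinv⟩ :=
    exists_invariant_of_commuting_conjugates (ρ.comp H.subtype)
      (b := ⟨b, le_inertiaSubgroup B χ hb⟩) hcomm hbns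
  refine ⟨H'.map H.subtype, W, ?_, ?_, hbot, htop, ?_⟩
  · rw [Subgroup.index_map_subtype]
    exact mul_ne_zero hfin' hfin
  · rw [Subgroup.index_map_subtype, pow_succ', pow_two]
    exact Nat.mul_le_mul hle' (hle.trans_eq (Module.finrank_linearMap K K V V))
  · rintro _ ⟨h, hh, rfl⟩
    exact hinv h hh

end InvariantSubspaces

section Trigonalizable

variable {K G V : Type*} [Field K] [Group G] [AddCommGroup V] [Module K V]

/-- The group acts by scalars on the quotient `W' / W`. -/
def IsScalarStep (ρ : Representation K G V) (W W' : Submodule K V) : Prop :=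
  W ≤ W' ∧ ∀ g, ∀ w ∈ W', ∃ c : K, ρ g w - c • w ∈ W

/-- A trigonalizable representation, encoded without coordinates: `V` has a finite filtration with
scalar action on the successive quotients, which can then be refined to a full invariant flag. -/
def IsTrigonalizableRep (ρ : Representation K G V) : Prop :=
  Relation.ReflTransGen (IsScalarStep ρ) ⊥ ⊤

theorem isTrigonalizableRep_of_forall_scalar {ρ : Representation K G V}
    (h : ∀ g, ∃ c : K, ρ g = c • 1) : IsTrigonalizableRep ρ := by
  refine .single ⟨bot_le, fun g w _ => ?_⟩
  obtain ⟨c, hc⟩ := h g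
  exact ⟨c, by simp [hc]⟩

namespace IsTrigonalizableRep

variable {ρ : Representation K G V}

theorem of_range_subset {H : Type*} [Group H] {σ : Representation K H V}
    (hρ : IsTrigonalizableRep ρ) (h : ∀ x, ∃ g, σ x = ρ g) : IsTrigonalizableRep σ :=
  Relation.ReflTransGen.mono (p := IsScalarStep σ) (fun _ _ step =>
    ⟨step.1, fun x w hw => by
      obtain ⟨g, hg⟩ := h x
      exact hg ▸ step.2 g w hw⟩) _ _ hρ

theorem comp {H : Type*} [Group H] (hρ : IsTrigonalizableRep ρ) (f : H →* G) :
    IsTrigonalizableRep (V := V) (MonoidHom.comp ρ f) :=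
  hρ.of_range_subset fun x => ⟨f x, rfl⟩

theorem subrepresentation (hρ : IsTrigonalizableRep ρ) (W : Submodule K V)
    (hW : ∀ g, W ≤ W.comap (ρ g)) : IsTrigonalizableRep (ρ.subrepresentation W hW) := by
  have step_comap (U U' : Submodule K V) (h : IsScalarStep ρ U U') :
      IsScalarStep (ρ.subrepresentation W hW) (U.comap W.subtype) (U'.comap W.subtype) :=
    ⟨Submodule.comap_mono h.1, fun g w hw => h.2 g w hw⟩
  simpa [IsTrigonalizableRep, Function.onFun] using
    Relation.ReflTransGen.lift _ step_comap _ _ hρ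

theorem quotient (hρ : IsTrigonalizableRep ρ) (W : Submodule K V)
    (hW : ∀ g, W ≤ W.comap (ρ g)) : IsTrigonalizableRep (ρ.quotient W hW) := by
  have step_map (U U' : Submodule K V) (h : IsScalarStep ρ U U') :
      IsScalarStep (ρ.quotient W hW) (U.map W.mkQ) (U'.map W.mkQ) := by
    refine ⟨Submodule.map_mono h.1, ?_⟩
    rintro g _ ⟨w, hw, rfl⟩
    obtain ⟨c, hc⟩ := h.2 g w hw
    exact ⟨c, _, hc, rfl⟩
  simpa [IsTrigonalizableRep, Function.onFun, Submodule.range_mkQ] using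
    Relation.ReflTransGen.lift _ step_map _ _ hρ

theorem of_subrepresentation_of_quotient (W : Submodule K V) (hW : ∀ g, W ≤ W.comap (ρ g))
    (hsub : IsTrigonalizableRep (ρ.subrepresentation W hW))
    (hquot : IsTrigonalizableRep (ρ.quotient W hW)) : IsTrigonalizableRep ρ := by
  have step_map (U U' : Submodule K W) (h : IsScalarStep (ρ.subrepresentation W hW) U U') :
      IsScalarStep ρ (U.map W.subtype) (U'.map W.subtype) := by
    refine ⟨Submodule.map_mono h.1, ?_⟩
    rintro g _ ⟨w, hw, rfl⟩
    obtain ⟨c, hc⟩ := h.2 g w hw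
    exact ⟨c, _, hc, rfl⟩
  have step_comap (U U' : Submodule K (V ⧸ W)) (h : IsScalarStep (ρ.quotient W hW) U U') :
      IsScalarStep ρ (U.comap W.mkQ) (U'.comap W.mkQ) :=
    ⟨Submodule.comap_mono h.1, fun g w hw => h.2 g (W.mkQ w) hw⟩
  have below : Relation.ReflTransGen (IsScalarStep ρ) ⊥ W := by
    simpa [Function.onFun] using Relation.ReflTransGen.lift _ step_map _ _ hsub
  have above : Relation.ReflTransGen (IsScalarStep ρ) W ⊤ := by
    simpa [Function.onFun] using Relation.ReflTransGen.lift _ step_comap _ _ hquot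
  exact below.trans above

end IsTrigonalizableRep

end Trigonalizable

section Malcev

/-- The index bound in Mal'cev's theorem: a solvable group acting on a space of dimension at most
`n + 1` splits it after passing to a subgroup of index at most `(n + 1) ^ 3`, unless it acts by
scalars. -/
def malcevBound : ℕ → ℕ
  | 0 => 1
  | n + 1 => (n + 1) ^ 3 * (malcevBound n * malcevBound n)

theorem malcevBound_pos (n : ℕ) : 0 < malcevBound n := by
  induction n with
  | zero => exact Nat.one_pos
  | succ n ih => exact Nat.mul_pos (by positivity) (Nat.mul_pos ih ih)

theorem exists_isTrigonalizableRep_of_isSolvable {K : Type*} [Field K] [IsAlgClosed K] (n : ℕ)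
    {G : Type*} {V : Type*} [Group G] [Group.IsSolvable G] [AddCommGroup V] [Module K V]
    [FiniteDimensional K V] (ρ : Representation K G V) (hV : Module.finrank K V ≤ n) :
    ∃ H : Subgroup G, H.index ≠ 0 ∧ H.index ≤ malcevBound n ∧
      IsTrigonalizableRep (V := V) (MonoidHom.comp ρ H.subtype) := by
  induction n generalizing G V with
  | zero =>
    have : Subsingleton V := Module.finrank_zero_iff.1 (Nat.le_zero.1 hV)
    exact ⟨⊤, by simp, by simp [malcevBound],
      isTrigonalizableRep_of_forall_scalar fun _ => ⟨1, Subsingleton.elim _ _⟩⟩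
  | succ n ih =>
    by_cases hs : ∀ g, ∃ c : K, ρ g = c • 1
    · exact ⟨⊤, by simp, Subgroup.index_top.trans_le (malcevBound_pos (n + 1)),
        (isTrigonalizableRep_of_forall_scalar hs).comp _⟩
    push Not at hs
    obtain ⟨g, hg⟩ := hs
    obtain ⟨H, W, hH0, hH, hbot, htop, hinv⟩ := exists_invariant_of_isSolvable ρ hg
    let σ : Representation K H V := MonoidHom.comp ρ H.subtype
    have hσ (h : H) : W ≤ W.comap (σ h) := hinv h h.2
    have hdim := Submodule.finrank_quotient_add_finrank W
    obtain ⟨H₁, h₁0, h₁, t₁⟩ := ih (σ.subrepresentation W hσ)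
      (by have := Submodule.finrank_lt htop; omega)
    obtain ⟨H₂, h₂0, h₂, t₂⟩ := ih (σ.quotient W hσ)
      (by have := Submodule.one_le_finrank_iff.2 hbot; omega)
    refine ⟨(H₁ ⊓ H₂).map H.subtype, ?_, ?_, ?_⟩
    · rw [Subgroup.index_map_subtype]
      exact mul_ne_zero (Subgroup.index_inf_ne_zero h₁0 h₂0) hH0
    · rw [Subgroup.index_map_subtype, mul_comm, malcevBound]
      exact Nat.mul_le_mul (hH.trans (Nat.pow_le_pow_left hV 3))
        (Subgroup.index_inf_le.trans (Nat.mul_le_mul h₁ h₂))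
    · have htrig : IsTrigonalizableRep (V := V) (MonoidHom.comp σ (H₁ ⊓ H₂).subtype) :=
        .of_subrepresentation_of_quotient W (fun g => hσ g)
          (t₁.comp (Subgroup.inclusion inf_le_left)) (t₂.comp (Subgroup.inclusion inf_le_right))
      refine htrig.of_range_subset ?_
      rintro ⟨_, h, hh, rfl⟩
      exact ⟨⟨h, hh⟩, rfl⟩

end Malcev

section NormalPSubgroup

variable {K G V : Type*} [Field K] [Group G] [AddCommGroup V] [Module K V]

/-- The additive subgroup generated by the orbit of a nonzero vector is a finite `p`-group, so its
number of fixed points is divisible by `p`. -/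
theorem exists_fixed_ne_zero_of_isPGroup {p : ℕ} [Fact p.Prime] [CharP K p] [Finite G]
    [Nontrivial V] (hG : IsPGroup p G) (ρ : Representation K G V) :
    ∃ v : V, v ≠ 0 ∧ ∀ g, ρ g v = v := by
  obtain ⟨v₀, hv₀⟩ := exists_ne (0 : V)
  let A : AddSubgroup V := AddSubgroup.closure (Set.range fun g => ρ g v₀)
  have hA : ∀ g, ∀ a ∈ A, ρ g a ∈ A := by
    intro g
    change A ≤ A.comap (ρ g).toAddMonoidHom
    rw [AddSubgroup.closure_le]
    rintro _ ⟨h, rfl⟩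
    refine AddSubgroup.subset_closure ⟨g * h, ?_⟩
    simp
  have hpV : ∀ v : V, p • v = 0 := fun v => by
    rw [← Nat.cast_smul_eq_nsmul K, CharP.cast_eq_zero, zero_smul]
  have hfg : AddGroup.FG A := AddGroup.closure_finite_fg _
  have hfin : Finite A := AddCommGroup.finite_of_fg_isAddTorsion _ fun a =>
    isOfFinAddOrder_iff_nsmul_eq_zero.2 ⟨p, (Fact.out : p.Prime).pos, Subtype.ext (hpV a)⟩
  let _ : MulAction G A :=
    { smul := fun g a => ⟨ρ g a, hA g a a.2⟩
      one_smul := fun a => Subtype.ext (by change ρ 1 _ = _; simp)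
      mul_smul := fun g h a => Subtype.ext (by change ρ (g * h) _ = ρ g (ρ h _); simp) }
  have hv₀A : v₀ ∈ A := AddSubgroup.subset_closure ⟨1, by simp⟩
  have hdvd : p ∣ Nat.card A := by
    have h1 : addOrderOf (⟨v₀, hv₀A⟩ : A) = p :=
      addOrderOf_eq_prime (Subtype.ext (hpV v₀)) fun h => hv₀ (congrArg Subtype.val h)
    rw [← h1]
    exact addOrderOf_dvd_natCard _
  obtain ⟨v, hv, hne⟩ := hG.exists_fixed_point_of_prime_dvd_card_of_fixed_point A hdvd
    (a := 0) (fun g => Subtype.ext (map_zero (ρ g)))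
  exact ⟨v, fun h => hne (Subtype.ext h.symm), fun g => congrArg Subtype.val (hv g)⟩

theorem IsTrigonalizableRep.of_normal_isPGroup_sup {p : ℕ} [Fact p.Prime] [CharP K p]
    [FiniteDimensional K V] (ρ : Representation K G V) (S A : Subgroup G) [S.Normal] [Finite S]
    (hS : IsPGroup p S) (hSA : S ⊔ A = ⊤)
    (hρ : IsTrigonalizableRep (V := V) (MonoidHom.comp ρ A.subtype)) :
    IsTrigonalizableRep ρ := by
  induction hn : Module.finrank K V using Nat.strong_induction_on generalizing V with
  | _ n ih =>
  rcases subsingleton_or_nontrivial V with hV | hV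
  · exact isTrigonalizableRep_of_forall_scalar fun _ => ⟨1, Subsingleton.elim _ _⟩
  let W := Representation.invariants (MonoidHom.comp ρ S.subtype : Representation K S V)
  have hW (g : G) : W ≤ W.comap (ρ g) := Representation.le_comap_invariants ρ S g
  obtain ⟨v, hv0, hv⟩ := exists_fixed_ne_zero_of_isPGroup hS (MonoidHom.comp ρ S.subtype)
  have hW0 : W ≠ ⊥ := (Submodule.ne_bot_iff W).2 ⟨v, hv, hv0⟩
  refine .of_subrepresentation_of_quotient W hW ?_ ?_
  · refine (hρ.subrepresentation W fun a => hW a).of_range_subset fun g => ?_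
    obtain ⟨s, hs, a, ha, rfl⟩ := Subgroup.mem_sup_of_normal_left.1
      (hSA ▸ Subgroup.mem_top g : g ∈ S ⊔ A)
    refine ⟨⟨a, ha⟩, LinearMap.ext fun w => Subtype.ext ?_⟩
    have hfix : ρ s (ρ a w) = ρ a w := hW a w.2 ⟨s, hs⟩
    simpa [Representation.subrepresentation] using hfix
  · refine ih _ ?_ (ρ.quotient W hW) (hρ.quotient W fun a => hW a) rfl
    have hdim := Submodule.finrank_quotient_add_finrank W
    have := Submodule.one_le_finrank_iff.2 hW0
    omega

theorem IsTrigonalizableRep.sup_of_isPGroup {p : ℕ} [Fact p.Prime] [CharP K p]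
    [FiniteDimensional K V] (ρ : Representation K G V) (S A : Subgroup G) [Finite S]
    (hS : IsPGroup p S) (hA : A ≤ Subgroup.normalizer (S : Set G))
    (hρ : IsTrigonalizableRep (V := V) (MonoidHom.comp ρ A.subtype)) :
    IsTrigonalizableRep (V := V) (MonoidHom.comp ρ (S ⊔ A).subtype) := by
  have hnormal : (S.subgroupOf (S ⊔ A)).Normal :=
    Subgroup.normal_subgroupOf_of_le_normalizer (sup_le Subgroup.le_normalizer hA)
  have hS' : IsPGroup p (S.subgroupOf (S ⊔ A)) :=
    hS.comap_of_injective (S ⊔ A).subtype (S ⊔ A).subtype_injective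
  have : Finite (S.subgroupOf (S ⊔ A)) :=
    .of_equiv _ (Subgroup.subgroupOfEquivOfLe (le_sup_left : S ≤ S ⊔ A)).symm.toEquiv
  refine of_normal_isPGroup_sup _ _ (A.subgroupOf (S ⊔ A)) hS' ?_ ?_
  · rw [← Subgroup.subgroupOf_sup le_sup_left le_sup_right, Subgroup.subgroupOf_self]
  · exact hρ.of_range_subset fun a => ⟨⟨a, a.2⟩, rfl⟩

end NormalPSubgroup

section Weights

variable {K G V : Type*} [Field K] [Group G] [AddCommGroup V] [Module K V]

/-- A weight of a representation: a linear character through which the group acts on a line in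
the quotient of `V` by an invariant subspace. -/
def IsWeight (ρ : Representation K G V) (χ : G →* K) : Prop :=
  ∃ W : Submodule K V, (∀ g, W ≤ W.comap (ρ g)) ∧ ∃ w ∉ W, ∀ g, ρ g w - χ g • w ∈ W

theorem IsTrigonalizableRep.exists_isWeight_mod {ρ : Representation K G V}
    (hρ : IsTrigonalizableRep ρ) {W : Submodule K V} (hW : ∀ g, W ≤ W.comap (ρ g))
    (hne : W ≠ ⊤) : ∃ w ∉ W, ∃ χ : G →* K, ∀ g, ρ g w - χ g • w ∈ W := by
  obtain ⟨U, U', hUW, step, hU'W⟩ : ∃ U U', U ≤ W ∧ IsScalarStep ρ U U' ∧ ¬ U' ≤ W := by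
    by_contra! hstep
    have hle : ∀ U, Relation.ReflTransGen (IsScalarStep ρ) ⊥ U → U ≤ W := fun U hU => by
      induction hU with
      | refl => exact bot_le
      | tail _ hlast ih => exact hstep _ _ ih hlast
    exact hne (top_le_iff.1 (hle ⊤ hρ))
  obtain ⟨w, hwU', hwW⟩ := SetLike.not_le_iff_exists.1 hU'W
  have hw0 : W.mkQ w ≠ 0 := by simpa using hwW
  obtain ⟨χ, hχ⟩ := exists_eigencharacter (ρ.quotient W hW) hw0 fun g => by
    obtain ⟨c, hc⟩ := step.2 g w hwU'
    exact ⟨c, (Submodule.Quotient.eq W).2 (hUW hc)⟩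
  exact ⟨w, hwW, χ, fun g => (Submodule.Quotient.eq W).1 (hχ g)⟩

/-- The vectors `b` make `ρ` upper triangular with diagonal characters `χ`. -/
def IsTriangularFamily {m : ℕ} (ρ : Representation K G V) (b : Fin m → V) (χ : Fin m → G →* K) :
    Prop :=
  ∀ j g, ρ g (b j) - χ j g • b j ∈ Submodule.span K (b '' Set.Iio j)

namespace IsTriangularFamily

variable {ρ : Representation K G V} {m : ℕ} {b : Fin m → V} {χ : Fin m → G →* K}

theorem span_image_le_comap (h : IsTriangularFamily ρ b χ) {s : Set (Fin m)} (hs : IsLowerSet s)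
    (g : G) : Submodule.span K (b '' s) ≤ (Submodule.span K (b '' s)).comap (ρ g) := by
  rw [Submodule.span_le]
  rintro _ ⟨j, hj, rfl⟩
  have hsub : Set.Iio j ⊆ s := fun i hi => hs hi.le hj
  have := add_mem (Submodule.span_mono (Set.image_mono hsub) (h j g))
    (Submodule.smul_mem _ (χ j g) (Submodule.subset_span (Set.mem_image_of_mem b hj)))
  simpa using this

theorem snoc (h : IsTriangularFamily ρ b χ) {w : V} {ψ : G →* K}
    (hw : ∀ g, ρ g w - ψ g • w ∈ Submodule.span K (Set.range b)) :
    IsTriangularFamily ρ (Fin.snoc b w : Fin (m + 1) → V)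
      (Fin.snoc χ ψ : Fin (m + 1) → G →* K) := by
  intro j g
  induction j using Fin.lastCases with
  | last =>
    have hsub : Set.range b ⊆ (Fin.snoc b w : Fin (m + 1) → V) '' Set.Iio (Fin.last m) := by
      rintro _ ⟨i, rfl⟩
      exact ⟨i.castSucc, Fin.castSucc_lt_last i, by simp⟩
    simpa using Submodule.span_mono hsub (hw g)
  | cast j =>
    have hsub : b '' Set.Iio j ⊆ (Fin.snoc b w : Fin (m + 1) → V) '' Set.Iio j.castSucc := by
      rintro _ ⟨i, hi, rfl⟩
      exact ⟨i.castSucc, Fin.castSucc_lt_castSucc_iff.2 hi, by simp⟩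
    simpa using Submodule.span_mono hsub (h j g)

theorem isWeight (h : IsTriangularFamily ρ b χ) (hb : LinearIndependent K b) (j : Fin m) :
    IsWeight ρ (χ j) :=
  ⟨_, h.span_image_le_comap (isLowerSet_Iio j), b j,
    hb.notMem_span_image (Set.self_notMem_Iio), h j⟩

theorem mem_span_Iio_sup_of_mem_span_Iic_sup (h : IsTriangularFamily ρ b χ) {ψ : G →* K}
    {W : Submodule K V} (hW : ∀ g, W ≤ W.comap (ρ g)) {w : V}
    (hw : ∀ g, ρ g w - ψ g • w ∈ W) {j : Fin m} (hj : χ j ≠ ψ)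
    (hwj : w ∈ Submodule.span K (b '' Set.Iic j) ⊔ W) :
    w ∈ Submodule.span K (b '' Set.Iio j) ⊔ W := by
  rw [← Set.Iio_insert, Set.image_insert_eq, Submodule.span_insert, sup_assoc] at hwj
  obtain ⟨_, hu, f, hf, rfl⟩ := Submodule.mem_sup.1 hwj
  obtain ⟨c, rfl⟩ := Submodule.mem_span_singleton.1 hu
  set U := Submodule.span K (b '' Set.Iio j) ⊔ W
  obtain ⟨g, hg⟩ := DFunLike.ne_iff.1 hj
  have hρf : ρ g f ∈ U :=
    (sup_le ((h.span_image_le_comap (isLowerSet_Iio j) g).trans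
      (Submodule.comap_mono le_sup_left)) ((hW g).trans (Submodule.comap_mono le_sup_right))) hf
  have hdiff : (χ j g - ψ g) • c • b j ∈ U := by
    have := sub_mem (add_mem (Submodule.mem_sup_right (hw g) : _ ∈ U) (U.smul_mem (ψ g) hf))
      (add_mem (U.smul_mem c (Submodule.mem_sup_left (h j g))) hρf)
    convert this using 1
    simp only [map_add, map_smul]
    module
  exact add_mem ((U.smul_mem_iff (sub_ne_zero.2 hg)).1 hdiff) hf

theorem eq_of_isWeight (h : IsTriangularFamily ρ b χ) (hb : Submodule.span K (Set.range b) = ⊤)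
    {ψ : G →* K} (hψ : IsWeight ρ ψ) : ∃ j, χ j = ψ := by
  obtain ⟨W, hW, w, hw, hwψ⟩ := hψ
  by_contra! hne
  have helim : ∀ k, w ∈ Submodule.span K (b '' {i | (i : ℕ) < k}) ⊔ W → w ∈ W := by
    intro k
    induction k with
    | zero => simp
    | succ k ih =>
      intro hwk
      rcases le_or_gt m k with hk | hk
      · have hset : {i : Fin m | (i : ℕ) < k + 1} = {i : Fin m | (i : ℕ) < k} :=
          Set.ext fun i => iff_of_true (i.2.trans_le (hk.trans k.le_succ)) (i.2.trans_le hk)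
        rw [hset] at hwk
        exact ih hwk
      · have hIic : {i : Fin m | (i : ℕ) < k + 1} = Set.Iic ⟨k, hk⟩ :=
          Set.ext fun i => Nat.lt_succ_iff
        have hIio : Set.Iio ⟨k, hk⟩ = {i : Fin m | (i : ℕ) < k} := Set.ext fun i => Iff.rfl
        rw [hIic] at hwk
        have hlower := h.mem_span_Iio_sup_of_mem_span_Iic_sup hW hwψ (hne ⟨k, hk⟩) hwk
        rw [hIio] at hlower
        exact ih hlower
  exact hw (helim m (by simp [hb]))

/-- If all the diagonal characters are trivial at `g`, then `ρ g - 1` is nilpotent. -/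
theorem pow_eq_one (h : IsTriangularFamily ρ b χ) (hb : Submodule.span K (Set.range b) = ⊤)
    {p : ℕ} [Fact p.Prime] [CharP K p] {g : G} (hg : ∀ j, χ j g = 1) : ρ (g ^ p ^ m) = 1 := by
  have hlower : ∀ k, ∀ v ∈ Submodule.span K (b '' {i | (i : ℕ) < k}), ((ρ g - 1) ^ k) v = 0 := by
    intro k
    induction k with
    | zero => simp
    | succ k ih =>
      have hle : Submodule.span K (b '' {i | (i : ℕ) < k + 1}) ≤
          (Submodule.span K (b '' {i | (i : ℕ) < k})).comap (ρ g - 1) := by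
        rw [Submodule.span_le]
        rintro _ ⟨j, hj, rfl⟩
        have hsub : Set.Iio j ⊆ {i | (i : ℕ) < k} := fun i hi =>
          lt_of_lt_of_le hi (Nat.lt_succ_iff.1 hj)
        simpa [hg j] using Submodule.span_mono (Set.image_mono hsub) (h j g)
      intro v hv
      rw [pow_succ]
      exact ih _ (hle hv)
  have hnil : (ρ g - 1) ^ m = 0 := LinearMap.ext fun v => hlower m v (by simp [hb])
  have hpow : (ρ g - 1) ^ p ^ m = 0 :=
    pow_eq_zero_of_le (Nat.lt_pow_self (Fact.out : p.Prime).one_lt).le hnil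
  rcases subsingleton_or_nontrivial V with hV | hV
  · exact Subsingleton.elim _ _
  have : CharP (Module.End K V) p := charP_of_injective_algebraMap (algebraMap K _).injective p
  rwa [sub_pow_char_pow_of_commute _ _ (Commute.one_right _), one_pow, sub_eq_zero,
    ← map_pow] at hpow

end IsTriangularFamily

theorem IsTrigonalizableRep.exists_triangular_basis [FiniteDimensional K V]
    {ρ : Representation K G V} (hρ : IsTrigonalizableRep ρ) {n : ℕ}
    (hn : Module.finrank K V = n) :
    ∃ (b : Module.Basis (Fin n) K V) (χ : Fin n → G →* K), IsTriangularFamily ρ b χ := by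
  have hfamily : ∀ m ≤ n, ∃ (b : Fin m → V) (χ : Fin m → G →* K),
      LinearIndependent K b ∧ IsTriangularFamily ρ b χ := by
    intro m
    induction m with
    | zero => exact fun _ => ⟨Fin.elim0, Fin.elim0, linearIndependent_empty_type, fun j => j.elim0⟩
    | succ m ih =>
      intro hm
      obtain ⟨b, χ, hb, hbχ⟩ := ih (by omega)
      have hne : Submodule.span K (Set.range b) ≠ ⊤ := fun htop => by
        have := finrank_span_eq_card hb
        rw [htop, finrank_top, Fintype.card_fin] at this
        omega
      obtain ⟨w, hw, ψ, hψ⟩ := hρ.exists_isWeight_mod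
        (by simpa using hbχ.span_image_le_comap isLowerSet_univ) hne
      exact ⟨_, _, hb.finSnoc hw, hbχ.snoc hψ⟩
  obtain ⟨b, χ, hb, hbχ⟩ := hfamily n le_rfl
  refine ⟨basisOfLinearIndependentOfCardEqFinrank' b hb (by simp [hn]), χ, ?_⟩
  simpa using hbχ

theorem IsTrigonalizableRep.ncard_isWeight_le [FiniteDimensional K V]
    {ρ : Representation K G V} (hρ : IsTrigonalizableRep ρ) :
    {χ | IsWeight ρ χ}.Finite ∧ {χ | IsWeight ρ χ}.ncard ≤ Module.finrank K V := by
  obtain ⟨b, χ, hbχ⟩ := hρ.exists_triangular_basis rfl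
  have hsub : {ψ | IsWeight ρ ψ} ⊆ Set.range χ := fun ψ hψ => hbχ.eq_of_isWeight b.span_eq hψ
  refine ⟨(Set.finite_range χ).subset hsub, (Set.ncard_le_ncard hsub (Set.finite_range χ)).trans ?_⟩
  simpa [Set.image_univ] using Set.ncard_image_le (f := χ) Set.finite_univ

/-- The elements on which every weight is trivial. For a trigonalizable representation these are
the elements acting unipotently. -/
def weightKernel (ρ : Representation K G V) : Subgroup G :=
  ⨅ (χ : G →* K) (_ : IsWeight ρ χ), χ.ker

theorem mem_weightKernel {ρ : Representation K G V} {g : G} :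
    g ∈ weightKernel ρ ↔ ∀ χ, IsWeight ρ χ → χ g = 1 := by
  simp only [weightKernel, Subgroup.mem_iInf, MonoidHom.mem_ker]

instance weightKernel_normal (ρ : Representation K G V) : (weightKernel ρ).Normal :=
  Subgroup.normal_iInf_normal fun _ => Subgroup.normal_iInf_normal fun _ => inferInstance

theorem IsTriangularFamily.isPGroup {p m : ℕ} [Fact p.Prime] [CharP K p]
    {ρ : Representation K G V} {b : Module.Basis (Fin m) K V} {χ : Fin m → G →* K}
    (hbχ : IsTriangularFamily ρ b χ) (hinj : Function.Injective ρ) {W : Subgroup G}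
    (hW : ∀ g ∈ W, ∀ j, χ j g = 1) : IsPGroup p W := by
  rintro ⟨g, hg⟩
  refine ⟨m, Subtype.ext (hinj ?_)⟩
  rw [Subgroup.coe_pow, Subgroup.coe_one, map_one]
  exact hbχ.pow_eq_one b.span_eq (hW g hg)

theorem IsTrigonalizableRep.isPGroup_weightKernel {p : ℕ} [Fact p.Prime] [CharP K p]
    [FiniteDimensional K V] {ρ : Representation K G V} (hρ : IsTrigonalizableRep ρ)
    (hinj : Function.Injective ρ) : IsPGroup p (weightKernel ρ) := by
  obtain ⟨b, χ, hbχ⟩ := hρ.exists_triangular_basis rfl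
  exact hbχ.isPGroup hinj fun g hg j =>
    mem_weightKernel.1 hg _ (hbχ.isWeight b.linearIndependent j)

theorem IsWeight.comp_conjNormal {ρ : Representation K G V} {A : Subgroup G} [A.Normal]
    {χ : A →* K} (hχ : IsWeight (ρ.comp A.subtype) χ) (g : G) :
    IsWeight (ρ.comp A.subtype) (χ.comp (MulAut.conjNormal g).toMonoidHom) := by
  obtain ⟨W, hW, w, hw, hwχ⟩ := hχ
  have hρ (a : A) (v : V) : ρ g (ρ a v) = ρ (MulAut.conjNormal g a : A) (ρ g v) := by
    rw [← Module.End.mul_apply, ← Module.End.mul_apply, ← map_mul, ← map_mul]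
    simp
  refine ⟨W.comap (ρ g), fun a v hv => ?_, ρ g⁻¹ w, by simpa using hw, fun a => ?_⟩
  · change ρ g (ρ a v) ∈ W
    rw [hρ]
    exact hW (MulAut.conjNormal g a) hv
  · change ρ g (ρ a (ρ g⁻¹ w) - χ (MulAut.conjNormal g a) • ρ g⁻¹ w) ∈ W
    rw [map_sub, hρ, map_smul, ρ.self_inv_apply]
    exact hwχ (MulAut.conjNormal g a)

/-- The permutation action by conjugation on the weights of a normal subgroup. -/
def weightPermHom (ρ : Representation K G V) (A : Subgroup G) [A.Normal] :
    G →* Equiv.Perm {χ // IsWeight (ρ.comp A.subtype) χ} :=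
  MonoidHom.toHomPerm
    { toFun g χ := ⟨χ.1.comp (MulAut.conjNormal g⁻¹).toMonoidHom, χ.2.comp_conjNormal g⁻¹⟩
      map_one' := funext fun χ => Subtype.ext <| MonoidHom.ext fun a => by
        change χ.1 (MulAut.conjNormal 1⁻¹ a) = χ.1 a
        simp
      map_mul' g h := funext fun χ => Subtype.ext <| MonoidHom.ext fun a => by
        change χ.1 (MulAut.conjNormal (g * h)⁻¹ a) =
          χ.1 (MulAut.conjNormal h⁻¹ (MulAut.conjNormal g⁻¹ a))
        simp }

theorem index_ker_weightPermHom_le [FiniteDimensional K V] (ρ : Representation K G V)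
    (A : Subgroup G) [A.Normal] (hρ : IsTrigonalizableRep (V := V) (ρ.comp A.subtype)) :
    (weightPermHom ρ A).ker.index ≤ (Module.finrank K V).factorial := by
  obtain ⟨hfin, hcard⟩ := hρ.ncard_isWeight_le
  have : Finite {χ // IsWeight (ρ.comp A.subtype) χ} := hfin
  rw [Subgroup.index_ker]
  refine (Subgroup.card_le_card_group _).trans ?_
  rw [Nat.card_perm]
  exact Nat.factorial_le hcard

theorem inv_mul_conjNormal_mem_weightKernel {ρ : Representation K G V} {A : Subgroup G} [A.Normal]
    {g : G} (hg : g ∈ (weightPermHom ρ A).ker) (a : A) :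
    a⁻¹ * MulAut.conjNormal g a ∈ weightKernel (ρ.comp A.subtype) := by
  refine mem_weightKernel.2 fun χ hχ => ?_
  have hperm : weightPermHom ρ A g⁻¹ ⟨χ, hχ⟩ = ⟨χ, hχ⟩ := DFunLike.congr_fun (inv_mem hg) _
  have hfix : χ (MulAut.conjNormal g⁻¹⁻¹ a) = χ a :=
    DFunLike.congr_fun (congrArg Subtype.val hperm) a
  rw [inv_inv] at hfix
  rw [map_mul, hfix, ← map_mul, inv_mul_cancel, map_one]

end Weights

section Matrices

open Matrix

variable {G K : Type*} [Group G] [Field K] {n : ℕ}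

/-- The action on column vectors of a group of matrices. -/
def matrixRepresentation (ρ : G →* GL (Fin n) K) : Representation K G (Fin n → K) :=
  (toLinAlgEquiv' : Matrix (Fin n) (Fin n) K ≃ₐ[K] _).toMonoidHom.comp
    ((Units.coeHom (Matrix (Fin n) (Fin n) K)).comp ρ)

theorem matrixRepresentation_injective {ρ : G →* GL (Fin n) K} (hρ : Function.Injective ρ) :
    Function.Injective (matrixRepresentation ρ) :=
  toLinAlgEquiv'.injective.comp (Units.val_injective.comp hρ)

theorem IsTriangularFamily.blockTriangular_toMatrix {V : Type*} [AddCommGroup V] [Module K V]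
    {ρ : Representation K G V} {b : Module.Basis (Fin n) K V} {χ : Fin n → G →* K}
    (h : IsTriangularFamily ρ b χ) (g : G) : (LinearMap.toMatrix b b (ρ g)).BlockTriangular id := by
  intro i j hij
  have hmem : ρ g (b j) ∈ Submodule.span K (b '' Set.Iic j) :=
    h.span_image_le_comap (isLowerSet_Iic j) g (Submodule.subset_span ⟨j, Set.self_mem_Iic, rfl⟩)
  rw [LinearMap.toMatrix_apply]
  by_contra hne
  exact not_lt_of_ge (b.mem_span_image.1 hmem (Finsupp.mem_support_iff.2 hne)) hij

theorem IsTrigonalizableRep.exists_conj_blockTriangular {ρ : G →* GL (Fin n) K}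
    (h : IsTrigonalizableRep (matrixRepresentation ρ)) :
    ∃ x : GL (Fin n) K, ∀ g, (x * ρ g * x⁻¹).val.BlockTriangular id := by
  obtain ⟨b, χ, hbχ⟩ := h.exists_triangular_basis (n := n) (by simp)
  let e := Pi.basisFun K (Fin n)
  let x : GL (Fin n) K :=
    ⟨b.toMatrix e, e.toMatrix b, b.toMatrix_mul_toMatrix_flip e, e.toMatrix_mul_toMatrix_flip b⟩
  refine ⟨x, fun g => ?_⟩
  have hconj := basis_toMatrix_mul_linearMap_toMatrix_mul_basis_toMatrix b e b e
    (matrixRepresentation ρ g)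
  have hstd : LinearMap.toMatrix e e (matrixRepresentation ρ g) = (ρ g).val :=
    LinearMap.toMatrix'_toLin' _
  rw [hstd] at hconj
  change (b.toMatrix e * (ρ g).val * e.toMatrix b).BlockTriangular id
  rw [hconj]
  exact hbχ.blockTriangular_toMatrix g

theorem isTrigonalizable_map {F E : Type u} [Field F] [Field E] [Algebra F E]
    (ρ : G →* GL (Fin n) F) (B : Subgroup G)
    (h : IsTrigonalizableRep (V := Fin n → E) ((matrixRepresentation
      ((GeneralLinearGroup.map (algebraMap F E)).comp ρ)).comp B.subtype)) :
    IsTrigonalizable (B.map ρ) := by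
  obtain ⟨x, hx⟩ := IsTrigonalizableRep.exists_conj_blockTriangular
    (ρ := ((GeneralLinearGroup.map (algebraMap F E)).comp ρ).comp B.subtype) h
  refine ⟨E, inferInstance, inferInstance, x, ?_⟩
  rintro _ ⟨b, hb, rfl⟩
  exact hx ⟨b, hb⟩

end Matrices

section GroupTheory

variable {G Q : Type*} [Group G] [Group Q] {p : ℕ}

theorem le_pCore (W : Subgroup G) [W.Normal] (hW : IsPGroup p W) : W ≤ pCore p G :=
  le_sSup ⟨inferInstance, hW⟩

theorem isPGroup_pCore (p : ℕ) (G : Type*) [Group G] : IsPGroup p (pCore p G) :=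
  Sylow.sSup_of_normal _ (fun _ h => h.2) fun _ h => h.1

instance pCore_characteristic : (pCore p G).Characteristic := by
  refine Subgroup.characteristic_iff_map_le.2 fun φ => ?_
  rw [Subgroup.map_le_iff_le_comap]
  refine sSup_le fun W ⟨hnormal, hW⟩ => ?_
  have := hnormal.map φ.toMonoidHom φ.surjective
  exact Subgroup.map_le_iff_le_comap.1 (le_pCore _ (hW.map _))

theorem pCore_eq_bot_of_ker_eq {f : G →* Q} (hf : Function.Surjective f)
    (hker : f.ker = pCore p G) : pCore p Q = ⊥ := by
  have hcomap : IsPGroup p ((pCore p Q).comap f) :=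
    (isPGroup_pCore p Q).comap_of_ker_isPGroup f (hker ▸ isPGroup_pCore p G)
  rw [eq_bot_iff, ← Subgroup.map_comap_eq_self_of_surjective hf (pCore p Q),
    Subgroup.map_le_iff_le_comap, MonoidHom.comap_bot, hker]
  exact le_pCore _ hcomap

theorem le_ker_of_pCore_eq_bot (hQ : pCore p Q = ⊥) (f : G →* Q) [f.range.Normal]
    (W : Subgroup G) [hnormal : W.Normal] (hW : IsPGroup p W) : W ≤ f.ker := by
  have := hnormal.map f.rangeRestrict f.rangeRestrict_surjective
  have hrange : W.map f.rangeRestrict ≤ pCore p f.range := le_pCore _ (hW.map _)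
  have hcore : (pCore p f.range).map f.range.subtype ≤ pCore p Q :=
    le_pCore _ ((isPGroup_pCore p _).map _)
  rw [hQ] at hcore
  intro w hw
  exact hcore (Subgroup.mem_map_of_mem _ (hrange (Subgroup.mem_map_of_mem _ hw)))

/-- The subgroup generated by the `m`-th powers. -/
def powSubgroup (m : ℕ) (G : Type*) [Group G] : Subgroup G :=
  Subgroup.closure (Set.range fun g : G => g ^ m)

theorem pow_mem_powSubgroup (m : ℕ) (g : G) : g ^ m ∈ powSubgroup m G :=
  Subgroup.subset_closure ⟨g, rfl⟩

theorem powSubgroup_map (m : ℕ) {f : G →* Q} (hf : Function.Surjective f) :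
    (powSubgroup m G).map f = powSubgroup m Q := by
  rw [powSubgroup, powSubgroup, MonoidHom.map_closure, ← Set.range_comp,
    ← hf.range_comp fun q : Q => q ^ m]
  simp only [Function.comp_def, map_pow]

instance powSubgroup_characteristic (m : ℕ) : (powSubgroup m G).Characteristic :=
  Subgroup.characteristic_iff_map_le.2 fun φ => (powSubgroup_map m φ.surjective).le

theorem map_powSubgroup_sup_ker (m : ℕ) (f : G →* Q) :
    (powSubgroup m G ⊔ f.ker).map f = (powSubgroup m f.range).map f.range.subtype := by
  rw [Subgroup.map_sup, (Subgroup.map_eq_bot_iff _).2 le_rfl, sup_bot_eq,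
    ← powSubgroup_map m f.rangeRestrict_surjective, Subgroup.map_map]
  rfl

theorem index_powSubgroup_sup_ker (m : ℕ) (f : G →* Q) :
    (powSubgroup m G ⊔ f.ker).index = (powSubgroup m f.range).index := by
  rw [← Subgroup.index_comap_of_surjective _ f.rangeRestrict_surjective,
    ← powSubgroup_map m f.rangeRestrict_surjective, Subgroup.comap_map_eq, f.ker_rangeRestrict]

theorem powSubgroup_le {m : ℕ} (U : Subgroup G) [U.Normal] (h : U.index ∣ m) :
    powSubgroup m G ≤ U := by
  refine (Subgroup.closure_le U).2 (Set.range_subset_iff.2 fun g => ?_)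
  obtain ⟨k, rfl⟩ := h
  rw [pow_mul]
  exact U.pow_mem (U.pow_index_mem g) k

theorem index_range_powMonoidHom_le {K ι : Type*} [Field K] [Fintype ι] {m : ℕ} (hm : m ≠ 0)
    (A : Subgroup (ι → Kˣ)) [Finite A] :
    (powMonoidHom m : A →* A).range.index ≤ m ^ Fintype.card ι := by
  have : NeZero m := ⟨hm⟩
  rw [Subgroup.index_range]
  let f (a : (powMonoidHom m : A →* A).ker) (i : ι) : rootsOfUnity m K :=
    ⟨a.1.1 i, congrFun (congrArg Subtype.val a.2) i⟩
  have hf : Function.Injective f := fun a b h =>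
    Subtype.ext (Subtype.ext (funext fun i => congrArg Subtype.val (congrFun h i)))
  refine (Nat.card_le_card_of_injective f hf).trans ?_
  rw [Nat.card_fun, Nat.card_eq_fintype_card (α := ι)]
  exact Nat.pow_le_pow_left (card_rootsOfUnity K m) _

theorem index_le_pow_card {K ι : Type*} [Field K] [Fintype ι] [Finite G] {m : ℕ} (hm : m ≠ 0)
    {δ : G →* ι → Kˣ} {M : Subgroup G} (hker : δ.ker ≤ M) (hpow : ∀ g, g ^ m ∈ M) :
    M.index ≤ m ^ Fintype.card ι := by
  have : Finite δ.range := Finite.of_surjective _ δ.rangeRestrict_surjective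
  have hle : (powMonoidHom m : δ.range →* δ.range).range ≤ M.map δ.rangeRestrict := by
    rintro _ ⟨a, rfl⟩
    obtain ⟨g, rfl⟩ := δ.rangeRestrict_surjective a
    exact ⟨g ^ m, hpow g, map_pow _ _ _⟩
  rw [← Subgroup.index_map_eq M δ.rangeRestrict_surjective (δ.ker_rangeRestrict.trans_le hker)]
  exact (Subgroup.index_antitone hle).trans (index_range_powMonoidHom_le hm _)

theorem index_powSubgroup_le {K ι : Type*} [Field K] [Fintype ι] [Finite G] [Finite Q] {m : ℕ}
    (hm : m ≠ 0) {f : G →* Q} {δ : G →* ι → Kˣ} (hker : δ.ker ≤ f.ker) :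
    (powSubgroup m Q).index ≤ f.range.index * m ^ Fintype.card ι := by
  have hM : ((powSubgroup m Q).comap f).index ≤ m ^ Fintype.card ι :=
    index_le_pow_card hm (hker.trans (Subgroup.ker_le_comap f _)) fun g => by
      rw [Subgroup.mem_comap, map_pow]
      exact pow_mem_powSubgroup m _
  rw [mul_comm]
  refine le_trans ?_ (Nat.mul_le_mul_right _ hM)
  rw [Subgroup.index_comap, Subgroup.relIndex, ← Subgroup.index_map_subtype,
    Subgroup.subgroupOf_map_subtype]
  exact Subgroup.index_antitone inf_le_left

theorem index_normalCore_le (H : Subgroup G) [H.FiniteIndex] :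
    H.normalCore.index ≤ H.index.factorial := by
  have : Finite (G ⧸ H) := Subgroup.finite_quotient_of_finiteIndex
  rw [Subgroup.normalCore_eq_ker, Subgroup.index_ker, Subgroup.index_eq_card, ← Nat.card_perm]
  exact Subgroup.card_le_card_group _

theorem subgroupOf_le_frattini {X P : Subgroup G}
    (hX : Minimal (fun Y : Subgroup G => Y ⊔ P = ⊤) X) : P.subgroupOf X ≤ frattini X := by
  refine le_iInf₂ fun M hM => by_contra fun hPM => hM.1 ?_
  have hsup : (M ⊔ P.subgroupOf X).map X.subtype = X := by
    rw [hM.2 _ (left_lt_sup.2 hPM), ← MonoidHom.range_eq_map, Subgroup.range_subtype]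
  rw [Subgroup.map_sup, Subgroup.subgroupOf_map_subtype] at hsup
  have htop : M.map X.subtype ⊔ P = ⊤ := by
    rw [← top_le_iff, ← hX.prop]
    exact sup_le (hsup.ge.trans (sup_le_sup_left inf_le_left _)) le_sup_right
  have hXM : X ≤ M.map X.subtype := hX.le_of_le htop (Subgroup.map_subtype_le M)
  exact top_le_iff.1 fun x _ => (Subgroup.mem_map_iff_mem X.subtype_injective).1 (hXM x.2)

theorem exists_le_sup_eq_top_isSolvable [Finite G] {N P : Subgroup G} (hNP : N ⊔ P = ⊤) :
    ∃ X ≤ N, X ⊔ P = ⊤ ∧ Group.IsSolvable (P.subgroupOf X) := by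
  obtain ⟨X, hXN, hX⟩ := (Set.toFinite {Y : Subgroup G | Y ⊔ P = ⊤}).exists_le_minimal hNP
  have : Group.IsNilpotent (frattini X) := frattini_nilpotent
  exact ⟨X, hXN, hX.prop, Group.isSolvable_of_isSolvable_injective
    (Subgroup.inclusion_injective (subgroupOf_le_frattini hX))⟩

theorem isSolvable_comap (π : G →* Q) [Group.IsSolvable π.ker] (Γ : Subgroup Q)
    [Group.IsSolvable Γ] : Group.IsSolvable (Γ.comap π) :=
  Group.isSolvable_of_ker_le_range (Subgroup.inclusion (Subgroup.ker_le_comap π Γ))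
    (π.subgroupComap Γ) fun d hd => ⟨⟨d, congrArg Subtype.val hd⟩, rfl⟩

theorem map_sylow_eq_range [Finite G] [Fact p.Prime] (T : Sylow p G) {f : G →* Q}
    (hf : IsPGroup p f.range) : T.map f = f.range := by
  have htop : (⊤ : Subgroup f.range) ≤ T.map f.rangeRestrict :=
    (hf.to_subgroup ⊤).le_sylow_of_normal (T.mapSurjective f.rangeRestrict_surjective)
  refine le_antisymm (Subgroup.map_le_range f _) ?_
  rintro _ ⟨x, rfl⟩
  obtain ⟨t, ht, htx⟩ := htop (Subgroup.mem_top (f.rangeRestrict x))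
  exact ⟨t, ht, congrArg Subtype.val htx⟩

end GroupTheory

section Sections

variable {G : Type*} [Group G] {H N : Subgroup G}

theorem sectionTrace_eq_univ (hNH : N ≤ H) {B : Set G}
    (hB : ∀ h ∈ H, ∃ b ∈ B, b⁻¹ * h ∈ N) : sectionTrace B H N = Set.univ := by
  refine Set.eq_univ_of_forall fun q => ?_
  obtain ⟨h, rfl⟩ := QuotientGroup.mk_surjective q
  obtain ⟨b, hb, hbh⟩ := hB h h.2
  have hbH : b ∈ H := by simpa using H.mul_mem h.2 (H.inv_mem (hNH hbh))
  exact ⟨⟨b, hbH⟩, hb, QuotientGroup.eq.2 hbh⟩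

variable [(N.subgroupOf H).Normal]

theorem sectionPreimage_le (L : Subgroup (SectionQuot H N)) : sectionPreimage H N L ≤ H :=
  Subgroup.map_subtype_le _

theorem coe_mem_sectionPreimage {L : Subgroup (SectionQuot H N)} {h : H} :
    (h : G) ∈ sectionPreimage H N L ↔ (QuotientGroup.mk h : SectionQuot H N) ∈ L :=
  Subgroup.mem_map_iff_mem H.subtype_injective

theorem le_sectionPreimage (hNH : N ≤ H) (L : Subgroup (SectionQuot H N)) :
    N ≤ sectionPreimage H N L := by
  intro g hg
  refine (coe_mem_sectionPreimage (h := ⟨g, hNH hg⟩)).2 ?_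
  rw [(QuotientGroup.eq_one_iff _).2 (Subgroup.mem_subgroupOf.2 hg)]
  exact one_mem L

theorem le_sectionNormalizer (hNH : N ≤ H) : H ≤ sectionNormalizer H N :=
  le_inf Subgroup.le_normalizer ((Subgroup.normal_subgroupOf_iff_le_normalizer hNH).1 inferInstance)

theorem conj_mem_sectionPreimage (L : Subgroup (SectionQuot H N)) [hL : L.Characteristic] {r g : G}
    (hr : r ∈ sectionNormalizer H N) (hg : g ∈ sectionPreimage H N L) :
    r * g * r⁻¹ ∈ sectionPreimage H N L := by
  obtain ⟨h, hh, rfl⟩ := hg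
  let e : H ≃* H := H.normalizerMonoidHom ⟨r, hr.1⟩
  have hN : (N.subgroupOf H).map e.toMonoidHom = N.subgroupOf H := by
    ext x
    obtain ⟨y, rfl⟩ := e.surjective x
    rw [Subgroup.mem_map_equiv, e.symm_apply_apply]
    exact Subgroup.mem_normalizer_iff.1 hr.2 y
  have hconj := Subgroup.characteristic_iff_le_comap.1 hL (QuotientGroup.congr _ _ e hN) hh
  exact ⟨e h, hconj, rfl⟩

theorem sectionNormalizer_le_normalizer_sectionPreimage (L : Subgroup (SectionQuot H N))
    [L.Characteristic] :
    sectionNormalizer H N ≤ Subgroup.normalizer (sectionPreimage H N L : Set G) := by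
  refine fun r hr => Subgroup.mem_normalizer_iff.2 fun g =>
    ⟨conj_mem_sectionPreimage L hr, fun hg => ?_⟩
  simpa [mul_assoc] using conj_mem_sectionPreimage L (inv_mem hr) hg

instance subgroupOf_sectionPreimage_normal (L : Subgroup (SectionQuot H N)) [L.Characteristic] :
    ((sectionPreimage H N L).subgroupOf (sectionNormalizer H N)).Normal :=
  Subgroup.normal_subgroupOf_of_le_normalizer (sectionNormalizer_le_normalizer_sectionPreimage L)

/-- The homomorphism `H / N → N_G(H / N) / M` induced by the inclusion of `H` in the normalizer of
the section, where `M / N = L`. Its kernel is `L`. -/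
def sectionQuotHom (hNH : N ≤ H) (L : Subgroup (SectionQuot H N)) [L.Characteristic] :
    SectionQuot H N →*
      sectionNormalizer H N ⧸ (sectionPreimage H N L).subgroupOf (sectionNormalizer H N) :=
  QuotientGroup.lift _ ((QuotientGroup.mk' _).comp (Subgroup.inclusion (le_sectionNormalizer hNH)))
    fun h hh => (QuotientGroup.eq_one_iff _).2 <| by
      refine Subgroup.mem_subgroupOf.2 (coe_mem_sectionPreimage.2 ?_)
      rw [(QuotientGroup.eq_one_iff h).2 hh]
      exact one_mem L

theorem exists_mem_sylow_inv_mul_mem {p : ℕ} [Fact p.Prime] {P : Type*} [Group P] [Finite P]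
    (T : Sylow p P) {L : Subgroup (SectionQuot H N)} (hL : IsPGroup p L) (f : P →* G)
    (hf : ∀ x, f x ∈ sectionPreimage H N L) (x : P) : ∃ t ∈ T, (f t)⁻¹ * f x ∈ N := by
  let φ : P →* SectionQuot H N :=
    (QuotientGroup.mk' _).comp (f.codRestrict H fun x => sectionPreimage_le L (hf x))
  have hφ : IsPGroup p φ.range := hL.to_le <| by
    rintro _ ⟨y, rfl⟩
    exact coe_mem_sectionPreimage.1 (hf y)
  obtain ⟨t, ht, htx⟩ : φ x ∈ (T : Subgroup P).map φ := map_sylow_eq_range T hφ ▸ ⟨x, rfl⟩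
  exact ⟨t, ht, (QuotientGroup.eq (s := N.subgroupOf H)).1 htx⟩

variable (hNH : N ≤ H) (L : Subgroup (SectionQuot H N)) [L.Characteristic]

theorem sectionQuotHom_ker : (sectionQuotHom hNH L).ker = L := by
  ext q
  obtain ⟨h, rfl⟩ := QuotientGroup.mk_surjective q
  exact (QuotientGroup.eq_one_iff _).trans coe_mem_sectionPreimage

instance sectionQuotHom_range_normal : (sectionQuotHom hNH L).range.Normal := by
  have hmap : (H.subgroupOf (sectionNormalizer H N)).map (QuotientGroup.mk' _) =
      (sectionQuotHom hNH L).range := by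
    ext q
    constructor
    · rintro ⟨r, hr, rfl⟩
      exact ⟨QuotientGroup.mk ⟨r, hr⟩, rfl⟩
    · rintro ⟨q, rfl⟩
      obtain ⟨h, rfl⟩ := QuotientGroup.mk_surjective q
      exact ⟨Subgroup.inclusion (le_sectionNormalizer hNH) h, h.2, rfl⟩
  have : (H.subgroupOf (sectionNormalizer H N)).Normal :=
    Subgroup.normal_subgroupOf_of_le_normalizer inf_le_left
  exact hmap ▸ this.map _ (QuotientGroup.mk'_surjective _)

theorem relIndex_sectionCentralizer_le (L' : Subgroup (SectionQuot H N)) [L'.Characteristic]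
    [Finite G] :
    (sectionCentralizer (sectionPreimage H N L') (sectionPreimage H N L)).relIndex
        (sectionNormalizer H N) ≤
      (Subgroup.centralizer (sectionQuotHom hNH L '' L')).index := by
  rw [← Subgroup.index_comap_of_surjective _ (QuotientGroup.mk'_surjective _)]
  refine Subgroup.index_antitone fun r hr => Subgroup.mem_subgroupOf.2
    ⟨⟨sectionNormalizer_le_normalizer_sectionPreimage L' r.2,
      sectionNormalizer_le_normalizer_sectionPreimage L r.2⟩, ?_⟩
  rintro _ ⟨h, hh, rfl⟩
  have hcomm := Subgroup.mem_centralizer_iff.1 hr _ (Set.mem_image_of_mem _ hh)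
  exact (QuotientGroup.eq (s := (sectionPreimage H N L).subgroupOf (sectionNormalizer H N))
    (a := Subgroup.inclusion (le_sectionNormalizer hNH) h)
    (b := r * Subgroup.inclusion (le_sectionNormalizer hNH) h * r⁻¹)).1
    (eq_mul_inv_iff_mul_eq.2 hcomm)

theorem sectionTrace_map_sup_eq_univ {p : ℕ} [Fact p.Prime] [Finite G] (hL : IsPGroup p L)
    (T : Sylow p (QuotientGroup.mk'
      ((sectionPreimage H N L).subgroupOf (sectionNormalizer H N))).ker)
    {A : Subgroup (sectionNormalizer H N)} {L' : Subgroup (SectionQuot H N)}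
    (hA : L'.map (sectionQuotHom hNH L) ≤ A.map (QuotientGroup.mk' _)) :
    sectionTrace ((T.map (Subgroup.subtype _) ⊔ A).map (Subgroup.subtype _) : Set G)
      (sectionPreimage H N L') N = Set.univ := by
  refine sectionTrace_eq_univ (le_sectionPreimage hNH L') ?_
  rintro _ ⟨h, hh, rfl⟩
  obtain ⟨a, ha, hah⟩ := hA (Subgroup.mem_map_of_mem _ hh)
  let x : (QuotientGroup.mk' ((sectionPreimage H N L).subgroupOf (sectionNormalizer H N))).ker :=
    ⟨a⁻¹ * Subgroup.inclusion (le_sectionNormalizer hNH) h,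
      (QuotientGroup.eq_one_iff _).2 (QuotientGroup.eq.1 hah)⟩
  obtain ⟨t, ht, htx⟩ := exists_mem_sylow_inv_mul_mem T hL
    ((Subgroup.subtype _).comp (Subgroup.subtype _))
    (fun y => Subgroup.mem_subgroupOf.1 ((QuotientGroup.eq_one_iff _).1 y.2)) x
  refine ⟨_, Subgroup.mem_map_of_mem _ (mul_mem (Subgroup.mem_sup_right ha)
    (Subgroup.mem_sup_left (Subgroup.mem_map_of_mem _ ht))), ?_⟩
  simpa [x, mul_assoc] using htx

end Sections

section SolvableLinearGroups

variable {K G Q V : Type*} [Field K] [IsAlgClosed K] [Group G] [Group Q] [AddCommGroup V]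
  [Module K V] [FiniteDimensional K V]

theorem exists_normal_isTrigonalizableRep [Group.IsSolvable G] (ρ : Representation K G V) :
    ∃ U : Subgroup G, U.Normal ∧ U.index ≠ 0 ∧
      U.index ≤ (malcevBound (Module.finrank K V)).factorial ∧
      IsTrigonalizableRep (V := V) (MonoidHom.comp ρ U.subtype) := by
  obtain ⟨U, hU0, hU, htrig⟩ := exists_isTrigonalizableRep_of_isSolvable _ ρ le_rfl
  have : U.FiniteIndex := ⟨hU0⟩
  exact ⟨U.normalCore, inferInstance, Subgroup.FiniteIndex.index_ne_zero,
    (index_normalCore_le U).trans (Nat.factorial_le hU),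
    htrig.comp (Subgroup.inclusion U.normalCore_le)⟩

/-- An exponent `m` such that the `m`-th powers of a solvable linear group of degree `n` generate a
trigonalizable subgroup. -/
def trigonalizableExponent (n : ℕ) : ℕ := (malcevBound n).factorial.factorial

/-- The constant `C(n)`: a trigonalizable normal subgroup has index at most the first factor, and
the group of `m`-th powers has index at most `m ^ n` in a finite diagonal group of degree `n`. -/
def trigonalizableBound (n : ℕ) : ℕ := (malcevBound n).factorial * trigonalizableExponent n ^ n

theorem index_dvd_trigonalizableExponent {n : ℕ} {U : Subgroup G} (hU0 : U.index ≠ 0)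
    (hU : U.index ≤ (malcevBound n).factorial) : U.index ∣ trigonalizableExponent n :=
  Nat.dvd_factorial (Nat.pos_of_ne_zero hU0) hU

theorem isTrigonalizableRep_powSubgroup [Group.IsSolvable G] (ρ : Representation K G V) :
    IsTrigonalizableRep (V := V) (MonoidHom.comp ρ
      (powSubgroup (trigonalizableExponent (Module.finrank K V)) G).subtype) := by
  obtain ⟨U, _, hU0, hU, htrig⟩ := exists_normal_isTrigonalizableRep ρ
  exact htrig.comp (Subgroup.inclusion (powSubgroup_le U (index_dvd_trigonalizableExponent hU0 hU)))

theorem index_powSubgroup_le_trigonalizableBound {p : ℕ} [Fact p.Prime] [CharP K p] [Finite G]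
    [Group.IsSolvable G] {ρ : Representation K G V} (hρ : Function.Injective ρ) {f : G →* Q}
    (hf : Function.Surjective f) (hQ : pCore p Q = ⊥) :
    (powSubgroup (trigonalizableExponent (Module.finrank K V)) Q).index ≤
      trigonalizableBound (Module.finrank K V) := by
  obtain ⟨U, hnormal, hU0, hU, htrig⟩ := exists_normal_isTrigonalizableRep ρ
  obtain ⟨b, χ, hbχ⟩ := htrig.exists_triangular_basis rfl
  let δ : U →* Fin (Module.finrank K V) → Kˣ := MonoidHom.pi fun i => (χ i).toHomUnits
  have hδ : IsPGroup p δ.ker := hbχ.isPGroup (hρ.comp Subtype.val_injective) fun u hu j =>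
    congrArg Units.val (congrFun (show δ u = 1 from hu) j)
  have hrange : (f.comp U.subtype).range = U.map f := by
    rw [MonoidHom.range_comp, Subgroup.range_subtype]
  have : (f.comp U.subtype).range.Normal := hrange ▸ hnormal.map f hf
  have : Finite Q := Finite.of_surjective f hf
  have hindex : (f.comp U.subtype).range.index ≤ U.index :=
    hrange ▸ Nat.le_of_dvd (Nat.pos_of_ne_zero hU0) (U.index_map_dvd hf)
  refine (index_powSubgroup_le (Nat.factorial_ne_zero _)
    (le_ker_of_pCore_eq_bot hQ (f.comp U.subtype) δ.ker hδ)).trans ?_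
  rw [Fintype.card_fin]
  exact Nat.mul_le_mul_right _ (hindex.trans hU)

end SolvableLinearGroups

section Centralizers

variable {K G H V : Type*} [Field K] [Group G] [Group H] [AddCommGroup V] [Module K V]
  [FiniteDimensional K V]

theorem index_centralizer_map_le (ρ : Representation K G V) {A : Subgroup G} [A.Normal]
    (hA : IsTrigonalizableRep (V := V) (MonoidHom.comp ρ A.subtype)) {π : G →* H}
    (hπ : Function.Surjective π)
    (hker : weightKernel (MonoidHom.comp ρ A.subtype) ≤ (π.comp A.subtype).ker) :
    (Subgroup.centralizer (A.map π : Set H)).index ≤ (Module.finrank K V).factorial := by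
  have : Finite {χ // IsWeight (MonoidHom.comp ρ A.subtype) χ} := hA.ncard_isWeight_le.1
  have hcentral : (weightPermHom ρ A).ker.map π ≤ Subgroup.centralizer (A.map π : Set H) := by
    rintro _ ⟨g, hg, rfl⟩
    refine Subgroup.mem_centralizer_iff.2 ?_
    rintro _ ⟨a, ha, rfl⟩
    have hcomm : π (a⁻¹ * (g * a * g⁻¹)) = 1 :=
      hker (inv_mul_conjNormal_mem_weightKernel hg ⟨a, ha⟩)
    rw [map_mul, map_inv, inv_mul_eq_one, map_mul, map_mul, map_inv] at hcomm
    exact eq_mul_inv_iff_mul_eq.1 hcomm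
  exact (Nat.le_of_dvd (Nat.pos_of_ne_zero Subgroup.FiniteIndex.index_ne_zero)
    ((Subgroup.index_dvd_of_le hcentral).trans (Subgroup.index_map_dvd _ hπ))).trans
    (index_ker_weightPermHom_le ρ A hA)

end Centralizers

section Quotients

variable {K G H V : Type*} [Field K] [IsAlgClosed K] [Group G] [Finite G] [Group H]
  [AddCommGroup V] [Module K V] [FiniteDimensional K V] {p : ℕ} [Fact p.Prime] [CharP K p]

theorem exists_lift_powSubgroup_of_isSolvable_ker {n : ℕ} (hV : Module.finrank K V = n)
    {ρ : Representation K G V} (hρ : Function.Injective ρ) {π : G →* H}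
    (hπ : Function.Surjective π) [Group.IsSolvable π.ker] (Γ : Subgroup H) [Γ.Normal]
    [Group.IsSolvable Γ] (hΓ : pCore p Γ = ⊥) :
    (powSubgroup (trigonalizableExponent n) Γ).index ≤ trigonalizableBound n ∧
      (Subgroup.centralizer
        (Γ.subtype '' powSubgroup (trigonalizableExponent n) Γ)).index ≤ n.factorial ∧
      ∃ A : Subgroup G, IsTrigonalizableRep (V := V) (MonoidHom.comp ρ A.subtype) ∧
        A.map π = (powSubgroup (trigonalizableExponent n) Γ).map Γ.subtype := by
  subst hV
  have := isSolvable_comap π Γ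
  let θ := π.subgroupComap Γ
  have hθ : Function.Surjective θ := π.subgroupComap_surjective_of_surjective Γ hπ
  let m := trigonalizableExponent (Module.finrank K V)
  let A : Subgroup G := (powSubgroup m (Γ.comap π)).map (Γ.comap π).subtype
  have hA : IsTrigonalizableRep (V := V) (MonoidHom.comp ρ A.subtype) := by
    refine (isTrigonalizableRep_powSubgroup
      (MonoidHom.comp ρ (Γ.comap π).subtype)).of_range_subset ?_
    rintro ⟨_, d, hd, rfl⟩
    exact ⟨⟨d, hd⟩, rfl⟩
  have hmap : A.map π = (powSubgroup m Γ).map Γ.subtype := by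
    rw [← powSubgroup_map _ hθ, Subgroup.map_map, Subgroup.map_map]
    rfl
  have hcore : weightKernel (MonoidHom.comp ρ A.subtype) ≤ (π.comp A.subtype).ker := by
    let f : A →* Γ := θ.comp (Subgroup.inclusion (Subgroup.map_subtype_le _))
    have hf : f.range = powSubgroup m Γ := by
      rw [← powSubgroup_map m hθ, MonoidHom.range_comp, Subgroup.inclusion_range,
        Subgroup.subgroupOf, Subgroup.comap_map_eq_self_of_injective (Subgroup.subtype_injective _)]
    have : f.range.Normal := hf ▸ inferInstance
    intro a ha
    exact congrArg Subtype.val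
      (le_ker_of_pCore_eq_bot hΓ f _ (hA.isPGroup_weightKernel (hρ.comp Subtype.val_injective)) ha)
  refine ⟨index_powSubgroup_le_trigonalizableBound (ρ := MonoidHom.comp ρ (Γ.comap π).subtype)
    (hρ.comp Subtype.val_injective) hθ hΓ, ?_, A, hA, hmap⟩
  rw [← Subgroup.coe_map, ← hmap]
  exact index_centralizer_map_le ρ hA hπ hcore

theorem exists_lift_powSubgroup {n : ℕ} (hV : Module.finrank K V = n) {ρ : Representation K G V}
    (hρ : Function.Injective ρ) {π : G →* H} (hπ : Function.Surjective π) (T : Sylow p π.ker)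
    (Γ : Subgroup H) [Γ.Normal] [Group.IsSolvable Γ] (hΓ : pCore p Γ = ⊥) :
    (powSubgroup (trigonalizableExponent n) Γ).index ≤ trigonalizableBound n ∧
      (Subgroup.centralizer
        (Γ.subtype '' powSubgroup (trigonalizableExponent n) Γ)).index ≤ n.factorial ∧
      ∃ A : Subgroup G,
        IsTrigonalizableRep (V := V) (MonoidHom.comp ρ (T.map π.ker.subtype ⊔ A).subtype) ∧
        A.map π = (powSubgroup (trigonalizableExponent n) Γ).map Γ.subtype := by
  obtain ⟨X, hXT, hX, hsolv⟩ := exists_le_sup_eq_top_isSolvable T.normalizer_sup_eq_top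
  have hπX : Function.Surjective (π.comp X.subtype) := fun h => by
    obtain ⟨g, rfl⟩ := hπ h
    obtain ⟨x, hx, k, hk, rfl⟩ := Subgroup.mem_sup_of_normal_right.1 (hX ▸ Subgroup.mem_top g)
    exact ⟨⟨x, hx⟩, by simpa using hk⟩
  have : Group.IsSolvable (π.comp X.subtype).ker := hsolv
  obtain ⟨hindex, hcentral, A, hA, hmap⟩ := exists_lift_powSubgroup_of_isSolvable_ker hV
    (ρ := MonoidHom.comp ρ X.subtype) (hρ.comp Subtype.val_injective) hπX Γ hΓ
  refine ⟨hindex, hcentral, A.map X.subtype, ?_, (Subgroup.map_map ..).trans hmap⟩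
  refine IsTrigonalizableRep.sup_of_isPGroup (p := p) ρ _ _ (T.isPGroup'.map _)
    ((Subgroup.map_subtype_le A).trans hXT) (hA.of_range_subset ?_)
  rintro ⟨_, a, ha, rfl⟩
  exact ⟨⟨a, ha⟩, rfl⟩

end Quotients

section SectionsOfLinearGroups

theorem exists_characteristic_isTrigonalizableRep {n p : ℕ} [Fact p.Prime] {K G V : Type*}
    [Field K] [IsAlgClosed K] [CharP K p] [Group G] [Finite G] [AddCommGroup V] [Module K V]
    [FiniteDimensional K V] (hV : Module.finrank K V = n) {ρ : Representation K G V}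
    (hρ : Function.Injective ρ) (Γ N : Subgroup G) [(N.subgroupOf Γ).Normal] (hNΓ : N ≤ Γ)
    [Group.IsSolvable (SectionQuot Γ N)] :
    ∃ S₀ : Subgroup (SectionQuot Γ N),
      S₀.Characteristic ∧
      (∃ B : Subgroup G, IsTrigonalizableRep (V := V) (MonoidHom.comp ρ B.subtype) ∧
        sectionTrace (B : Set G) (sectionPreimage Γ N S₀) N = Set.univ) ∧
      S₀.index ≤ trigonalizableBound n ∧
      pCore p (SectionQuot Γ N) ≤ S₀ ∧
      (sectionCentralizer (sectionPreimage Γ N S₀)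
          (sectionPreimage Γ N (pCore p (SectionQuot Γ N)))).relIndex
        (sectionNormalizer Γ N) ≤ n.factorial := by
  let f := sectionQuotHom hNΓ (pCore p (SectionQuot Γ N))
  have hker : f.ker = pCore p (SectionQuot Γ N) := sectionQuotHom_ker hNΓ _
  have hf : Function.Surjective f.rangeRestrict := f.rangeRestrict_surjective
  have : Group.IsSolvable f.range := Group.isSolvable_of_surjective hf
  obtain ⟨T⟩ : Nonempty (Sylow p (QuotientGroup.mk' ((sectionPreimage Γ N
    (pCore p (SectionQuot Γ N))).subgroupOf (sectionNormalizer Γ N))).ker) := inferInstance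
  obtain ⟨hindex, hcentral, A, hA, hmap⟩ := exists_lift_powSubgroup hV
    (ρ := MonoidHom.comp ρ (sectionNormalizer Γ N).subtype) (hρ.comp Subtype.val_injective)
    (QuotientGroup.mk'_surjective _) T f.range
    (pCore_eq_bot_of_ker_eq hf (f.ker_rangeRestrict.trans hker))
  let S₀ := powSubgroup (trigonalizableExponent n) (SectionQuot Γ N) ⊔ pCore p (SectionQuot Γ N)
  have hS₀ : S₀ = powSubgroup (trigonalizableExponent n) (SectionQuot Γ N) ⊔ f.ker := by
    rw [hker]
  have hS₀map : S₀.map f = (powSubgroup (trigonalizableExponent n) f.range).map f.range.subtype :=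
    hS₀ ▸ map_powSubgroup_sup_ker _ f
  refine ⟨S₀, inferInstance, ⟨(T.map (Subgroup.subtype _) ⊔ A).map (Subgroup.subtype _),
    hA.of_range_subset ?_,
    sectionTrace_map_sup_eq_univ hNΓ _ (isPGroup_pCore p _) T (hS₀map.trans hmap.symm).le⟩, ?_,
    le_sup_right, (relIndex_sectionCentralizer_le hNΓ _ S₀).trans ?_⟩
  · rintro ⟨_, b, hb, rfl⟩
    exact ⟨⟨b, hb⟩, rfl⟩
  · rwa [hS₀, index_powSubgroup_sup_ker]
  · rwa [← Subgroup.coe_map, hS₀map]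

end SectionsOfLinearGroups

theorem mainTheorem6_general {n p : ℕ} [Fact p.Prime] {F : Type u} [Field F] [CharP F p]
    {G : Type*} [Group G] [Finite G] {ρ : G →* Matrix.GeneralLinearGroup (Fin n) F}
    (hρ : Function.Injective ρ) (Γ N : Subgroup G) [(N.subgroupOf Γ).Normal] (hNΓ : N ≤ Γ)
    [Group.IsSolvable (SectionQuot Γ N)] :
    ∃ S₀ : Subgroup (SectionQuot Γ N),
      S₀.Characteristic ∧
      (∃ B : Subgroup G, IsTrigonalizable (B.map ρ) ∧
        sectionTrace (B : Set G) (sectionPreimage Γ N S₀) N = Set.univ) ∧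
      S₀.index ≤ trigonalizableBound n ∧
      pCore p (SectionQuot Γ N) ≤ S₀ ∧
      (sectionCentralizer (sectionPreimage Γ N S₀)
          (sectionPreimage Γ N (pCore p (SectionQuot Γ N)))).relIndex
        (sectionNormalizer Γ N) ≤ n.factorial := by
  let K := AlgebraicClosure F
  have : CharP K p := charP_of_injective_algebraMap (algebraMap F K).injective p
  have hρK : Function.Injective (matrixRepresentation
      ((Matrix.GeneralLinearGroup.map (algebraMap F K)).comp ρ)) :=
    matrixRepresentation_injective <|
      (Units.map_injective (Matrix.map_injective (algebraMap F K).injective)).comp hρ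
  obtain ⟨S₀, hchar, ⟨B, hB, htrace⟩, hbounds⟩ :=
    exists_characteristic_isTrigonalizableRep (p := p) (Module.finrank_fin_fun K) hρK Γ N hNΓ
  exact ⟨S₀, hchar, ⟨B, isTrigonalizable_map ρ B hB, htrace⟩, hbounds⟩

theorem mainTheorem6 :
    ∃ C : ℕ → ℕ, ∀ (n p : ℕ) (F : Type u) [Field F] [Finite F] [CharP F p]
      (Γ N : Subgroup (Matrix.GeneralLinearGroup (Fin n) F)) [(N.subgroupOf Γ).Normal],
      N ≤ Γ → Group.IsSolvable (SectionQuot Γ N) →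
      ∃ S₀ : Subgroup (SectionQuot Γ N),
        S₀.Characteristic ∧
        IsTrigonalizableSection (sectionPreimage Γ N S₀) N ∧
        S₀.index ≤ C n ∧
        pCore p (SectionQuot Γ N) ≤ S₀ ∧
        (sectionCentralizer (sectionPreimage Γ N S₀)
            (sectionPreimage Γ N (pCore p (SectionQuot Γ N)))).relIndex
          (sectionNormalizer Γ N) ≤ n.factorial := by
  refine ⟨trigonalizableBound, fun n p F _ _ _ Γ N _ hNΓ _ => ?_⟩
  have : Fact p.Prime := ⟨CharP.char_is_prime F p⟩
  simpa only [IsTrigonalizableSection, Subgroup.map_id] using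
    mainTheorem6_general (p := p) (ρ := MonoidHom.id _) Function.injective_id Γ N hNΓ
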